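/- Let $S$ be a non-compact Hausdorff semitopological semigroup, i.e. a semigroup with a Hausdorff topology for which all maps $\lambda_s:t\mapsto st$ and $r_s:t\mapsto ts$ $(s\in S)$ are continuous. Let $\mathcal{CB}(S)$ be the $C^*$-algebra of bounded continuous functions $f:S\to\mathbb{C}$, and put $L_sf=f\circ\lambda_s$ and $R_sf=f\circ r_s$. For a $C^*$-subalgebra $\mathcal F\subseteq\mathcal{CB}(S)$ containing the constants, let $S^{\mathcal F}$ be the spectrum of $\mathcal F$, i.e. the set of all multiplicative means on $\mathcal F$ (the multiplicative linear functionals $\mu$ on $\mathcal F$ with $\|\mu\|=\mu(1)=1$), with the Gelfand topology (pointwise convergence on $\mathcal F$). Let $Lmc(S)$ be the set of all $f\in\mathcal{CB}(S)$ such that, for every $\mu\in\beta S=S^{\mathcal{CB}(S)}$, the function $T_\mu f:s\mapsto\mu(L_sf)$ is in $\mathcal{CB}(S)$. Let $wap(S)$ be the set of all $f\in\mathcal{CB}(S)$ such that $\{R_sf:s\in S\}$ is relatively compact in the weak topology $\sigma(\mathcal{CB}(S),\mathcal{CB}(S)^*)$. Let $S^{Lmc}$ and $S^{wap}$ be the spectra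 of $Lmc(S)$ and $wap(S)$. On $S^{Lmc}$ consider the multiplication $\mu*\nu=\mu\circ T_\nu$, where $(T_\nu f)(s)=\nu(L_sf)$ for $f\in Lmc(S)$. Let $\varepsilon:S\to S^{Lmc}$, $\varepsilon(s)(f)=f(s)$, be the evaluation map, let $S^*=S^{Lmc}\setminus\varepsilon(S)$, and for $A\subseteq S$ let $\overline{A}$ be the closure of $\varepsilon(A)$ in $S^{Lmc}$. **Theorem.** Let $A\subseteq S$ be a zero set $A=f^{-1}(\{0\})$ of some $f\in Lmc(S)$, and let $A$ be unbounded, i.e. $\overline{A}\cap S^*\neq\emptyset$. Suppose that (i) $\operatorname{card}(S^{Lmc})=\operatorname{card}(\overline{A})$, and (ii) $\overline{A}\cap \operatorname{cl}_{S^{Lmc}}(S^**S^{Lmc})=\emptyset$, where $S^**S^{Lmc}=\{\mu*\nu:\mu\in S^*,\ \nu\in S^{Lmc}\}$. Then $\operatorname{card}(S^{wap})=\operatorname{card}(S^{Lmc})$. -/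

import Mathlib

open scoped BoundedContinuousFunction Topology

universe u

namespace SemitopologicalSemigroup

section Spectrum

variable {S : Type u} [TopologicalSpace S]

/-- The spectrum `S^F` of a space `F` of bounded continuous complex functions on `S`: the set of
all multiplicative means on `F`, i.e. of the linear functionals `μ : F → ℂ` with
`‖μ‖ ≤ 1 = μ 1` that are multiplicative on the products lying in `F` (so on all products, when
`F` is an algebra). -/
@[ext]
structure Spectrum (F : Submodule ℂ (S →ᵇ ℂ)) where
  toLin : F →ₗ[ℂ] ℂ
  map_one' : ∀ e : F, (e : S →ᵇ ℂ) = 1 → toLin e = 1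
  map_mul' : ∀ f g h : F, (h : S →ᵇ ℂ) = (f : S →ᵇ ℂ) * g → toLin h = toLin f * toLin g
  norm_le' : ∀ f : F, ‖toLin f‖ ≤ ‖(f : S →ᵇ ℂ)‖

/-- The Gelfand topology: the topology of pointwise convergence on `F`. -/
noncomputable instance Spectrum.instTopologicalSpace (F : Submodule ℂ (S →ᵇ ℂ)) :
    TopologicalSpace (Spectrum F) :=
  TopologicalSpace.induced (fun (μ : Spectrum F) (f : F) => μ.toLin f) inferInstance

/-- The evaluation map `ε : S → S^F`. -/
noncomputable def eval (F : Submodule ℂ (S →ᵇ ℂ)) (s : S) : Spectrum F where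
  toLin :=
    { toFun := fun f => (f : S →ᵇ ℂ) s
      map_add' := fun _ _ => rfl
      map_smul' := fun _ _ => rfl }
  map_one' := fun e he => by
    change (e : S →ᵇ ℂ) s = 1
    rw [he]; rfl
  map_mul' := fun f g h hh => by
    change (h : S →ᵇ ℂ) s = (f : S →ᵇ ℂ) s * (g : S →ᵇ ℂ) s
    rw [hh]; rfl
  norm_le' := fun f => (f : S →ᵇ ℂ).norm_coe_le_norm s

/-- On a self-adjoint algebra, a multiplicative mean is a limit of evaluations. -/
theorem Spectrum.exists_near {F : Submodule ℂ (S →ᵇ ℂ)} (h1 : (1 : S →ᵇ ℂ) ∈ F)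
    (hmul : ∀ f ∈ F, ∀ g ∈ F, f * g ∈ F) (hstar : ∀ f ∈ F, star f ∈ F)
    (μ : Spectrum F) (t : Finset F) {δ : ℝ} (hδ : 0 < δ) :
    ∃ s : S, ∀ f ∈ t, ‖(f : S →ᵇ ℂ) s - μ.toLin f‖ < δ := by
  classical
  by_contra! hcon
  -- the function `∑ |f - μ f|²` has mean zero but is bounded below by `δ²`
  let e : F := ⟨1, h1⟩
  have he : μ.toLin e = 1 := μ.map_one' e rfl
  let c : F → F := fun f => f - μ.toLin f • e
  have hc0 : ∀ f, μ.toLin (c f) = 0 := fun f => by simp [c, he]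
  have hcv : ∀ (f : F) (s : S), (c f : S →ᵇ ℂ) s = (f : S →ᵇ ℂ) s - μ.toLin f := fun f s => by
    simp [c, e]
  let d : F → F := fun f =>
    ⟨(c f : S →ᵇ ℂ) * star (c f : S →ᵇ ℂ), hmul _ (c f).2 _ (hstar _ (c f).2)⟩
  have hd0 : ∀ f, μ.toLin (d f) = 0 := fun f => by
    rw [μ.map_mul' (c f) ⟨star (c f : S →ᵇ ℂ), hstar _ (c f).2⟩ (d f) rfl, hc0, zero_mul]
  have hdv : ∀ (f : F) (s : S),
      (d f : S →ᵇ ℂ) s = ((‖(f : S →ᵇ ℂ) s - μ.toLin f‖ ^ 2 : ℝ) : ℂ) := fun f s => by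
    change (c f : S →ᵇ ℂ) s * star ((c f : S →ᵇ ℂ) s) = _
    rw [hcv]
    push_cast
    exact Complex.mul_conj' _
  let g : F := ∑ f ∈ t, d f
  have hg0 : μ.toLin g = 0 := by simp [g, hd0]
  let r : S → ℝ := fun s => ∑ f ∈ t, ‖(f : S →ᵇ ℂ) s - μ.toLin f‖ ^ 2
  have hgv : ∀ s, (g : S →ᵇ ℂ) s = (r s : ℂ) := fun s => by
    simp [g, r, hdv, BoundedContinuousFunction.sum_apply]
  have hr : ∀ s, δ ^ 2 ≤ r s := fun s => by
    obtain ⟨f, hf, hfs⟩ := hcon s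
    calc δ ^ 2 ≤ ‖(f : S →ᵇ ℂ) s - μ.toLin f‖ ^ 2 := by gcongr
      _ ≤ r s := Finset.single_le_sum
          (f := fun f : F => ‖(f : S →ᵇ ℂ) s - μ.toLin f‖ ^ 2) (fun _ _ => by positivity) hf
  let M : ℝ := ‖(g : S →ᵇ ℂ)‖ + δ ^ 2
  let k : F := (M : ℂ) • e - g
  have hk : μ.toLin k = (M : ℂ) := by simp [k, he, hg0]
  have hkn : ‖(k : S →ᵇ ℂ)‖ ≤ M - δ ^ 2 := by
    refine (BoundedContinuousFunction.norm_le (by simp [M])).2 fun s => ?_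
    have h2 : (k : S →ᵇ ℂ) s = ((M - r s : ℝ) : ℂ) := by simp [k, e, hgv]
    have h3 : r s ≤ ‖(g : S →ᵇ ℂ)‖ := by
      have h4 := (g : S →ᵇ ℂ).norm_coe_le_norm s
      rw [hgv, Complex.norm_real] at h4
      exact (le_abs_self _).trans h4
    have h5 := hr s
    rw [h2, Complex.norm_real, Real.norm_eq_abs, abs_le]
    constructor
    · have : 0 ≤ δ ^ 2 := by positivity
      simp only [M]; linarith
    · linarith
  have hfin := μ.norm_le' k
  rw [hk, Complex.norm_real] at hfin
  have h6 : M ≤ M - δ ^ 2 := (le_abs_self M).trans (hfin.trans hkn)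
  have : 0 < δ ^ 2 := by positivity
  linarith

/-- A multiplicative mean on a self-adjoint algebra extends to all bounded continuous
functions. -/
theorem Spectrum.exists_extension {F : Submodule ℂ (S →ᵇ ℂ)} (h1 : (1 : S →ᵇ ℂ) ∈ F)
    (hmul : ∀ f ∈ F, ∀ g ∈ F, f * g ∈ F) (hstar : ∀ f ∈ F, star f ∈ F) (μ : Spectrum F) :
    ∃ ν : Spectrum (⊤ : Submodule ℂ (S →ᵇ ℂ)),
      ∀ f : F, ν.toLin ⟨(f : S →ᵇ ℂ), trivial⟩ = μ.toLin f := by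
  classical
  let l : Filter S := ⨅ i : Finset F × {δ : ℝ // 0 < δ},
    Filter.principal {s | ∀ f ∈ i.1, ‖(f : S →ᵇ ℂ) s - μ.toLin f‖ < i.2.1}
  have hl : l.NeBot := by
    have : Nonempty (Finset F × {δ : ℝ // 0 < δ}) := ⟨(∅, ⟨1, one_pos⟩)⟩
    refine Filter.iInf_neBot_of_directed' ?_ ?_
    · rintro ⟨t, δ⟩ ⟨t', δ'⟩
      refine ⟨(t ∪ t', ⟨min δ.1 δ'.1, lt_min δ.2 δ'.2⟩), ?_, ?_⟩
      · refine Filter.principal_mono.2 fun s hs f hf => ?_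
        exact (hs f (Finset.mem_union_left _ hf)).trans_le (min_le_left _ _)
      · refine Filter.principal_mono.2 fun s hs f hf => ?_
        exact (hs f (Finset.mem_union_right _ hf)).trans_le (min_le_right _ _)
    · rintro ⟨t, δ⟩
      exact Filter.principal_neBot_iff.2 (Spectrum.exists_near h1 hmul hstar μ t δ.2)
  let U : Ultrafilter S := Ultrafilter.of l
  have hU : (U : Filter S) ≤ l := Ultrafilter.of_le l
  have hF : ∀ f : F, Filter.Tendsto (f : S →ᵇ ℂ) U (𝓝 (μ.toLin f)) := fun f => by
    refine Metric.tendsto_nhds.2 fun δ hδ => hU ?_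
    refine Filter.mem_iInf_of_mem (({f} : Finset F), ⟨δ, hδ⟩) ?_
    intro s hs
    simpa [dist_eq_norm] using hs f (Finset.mem_singleton_self f)
  have hex : ∀ f : S →ᵇ ℂ, ∃ z : ℂ, Filter.Tendsto f U (𝓝 z) := fun f => by
    obtain ⟨z, -, hz⟩ := (isCompact_closedBall (0 : ℂ) ‖f‖).ultrafilter_le_nhds (U.map f) (by
      rw [Filter.le_principal_iff]
      change ∀ᶠ s in (U : Filter S), f s ∈ Metric.closedBall (0 : ℂ) ‖f‖
      exact Filter.Eventually.of_forall fun s => mem_closedBall_zero_iff.2 (f.norm_coe_le_norm s))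
    exact ⟨z, hz⟩
  choose L hL using hex
  have hLu : ∀ {f : S →ᵇ ℂ} {z : ℂ}, Filter.Tendsto f U (𝓝 z) → L f = z := fun h =>
    tendsto_nhds_unique (hL _) h
  refine ⟨⟨⟨⟨fun f => L f, fun f g => hLu ((hL _).add (hL _))⟩,
    fun a f => hLu ((hL _).const_mul a)⟩, ?_, ?_, ?_⟩, fun f => hLu (hF f)⟩
  · intro e he
    change L (e : S →ᵇ ℂ) = 1
    rw [he]
    exact hLu tendsto_const_nhds
  · intro f g h hh
    change L (h : S →ᵇ ℂ) = L f * L g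
    rw [hh]
    exact hLu ((hL _).mul (hL _))
  · intro f
    exact le_of_tendsto (hL (f : S →ᵇ ℂ)).norm
      (Filter.Eventually.of_forall fun s => (f : S →ᵇ ℂ).norm_coe_le_norm s)

end Spectrum

section Compactification

variable {S : Type u} [Semigroup S] [TopologicalSpace S] [SeparatelyContinuousMul S]

/-- The left translate `L_s f = f ∘ λ_s`, i.e. `(L_s f)(t) = f (s t)`. -/
noncomputable def leftTranslate (s : S) (f : S →ᵇ ℂ) : S →ᵇ ℂ :=
  f.compContinuous ⟨fun t => s * t, continuous_const_mul s⟩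

/-- The right translate `R_s f = f ∘ r_s`, i.e. `(R_s f)(t) = f (t s)`. -/
noncomputable def rightTranslate (s : S) (f : S →ᵇ ℂ) : S →ᵇ ℂ :=
  f.compContinuous ⟨fun t => t * s, continuous_mul_const s⟩

theorem norm_leftTranslate_le (s : S) (f : S →ᵇ ℂ) : ‖leftTranslate s f‖ ≤ ‖f‖ :=
  (BoundedContinuousFunction.norm_le (norm_nonneg _)).2 fun t => f.norm_coe_le_norm (s * t)

theorem leftTranslate_leftTranslate (s t : S) (f : S →ᵇ ℂ) :
    leftTranslate t (leftTranslate s f) = leftTranslate (s * t) f := by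
  ext x
  exact congrArg f (mul_assoc s t x).symm

variable (S) in
/-- `Lmc(S)`: the bounded continuous functions `f` such that for every `μ` in the spectrum `βS` of
all bounded continuous functions, the (automatically bounded) function
`T_μ f : s ↦ μ (L_s f)` is continuous. -/
noncomputable def Lmc : Submodule ℂ (S →ᵇ ℂ) where
  carrier := {f | ∀ μ : Spectrum (⊤ : Submodule ℂ (S →ᵇ ℂ)),
    Continuous fun s : S => μ.toLin ⟨leftTranslate s f, trivial⟩}
  add_mem' := fun {f g} hf hg μ => by
    have h : ∀ s : S, μ.toLin ⟨leftTranslate s (f + g), trivial⟩ =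
        μ.toLin ⟨leftTranslate s f, trivial⟩ + μ.toLin ⟨leftTranslate s g, trivial⟩ :=
      fun s => μ.toLin.map_add ⟨leftTranslate s f, trivial⟩ ⟨leftTranslate s g, trivial⟩
    exact ((hf μ).add (hg μ)).congr fun s => (h s).symm
  zero_mem' := fun μ => by
    have h : ∀ s : S, μ.toLin ⟨leftTranslate s (0 : S →ᵇ ℂ), trivial⟩ = 0 :=
      fun s => μ.toLin.map_zero
    simpa only [h] using continuous_const
  smul_mem' := fun a f hf μ => by
    have h : ∀ s : S, μ.toLin ⟨leftTranslate s (a • f), trivial⟩ =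
        a • μ.toLin ⟨leftTranslate s f, trivial⟩ :=
      fun s => μ.toLin.map_smul a ⟨leftTranslate s f, trivial⟩
    exact ((hf μ).const_smul a).congr fun s => (h s).symm

theorem one_mem_Lmc : (1 : S →ᵇ ℂ) ∈ Lmc S := fun μ => by
  have h : ∀ s : S, μ.toLin ⟨leftTranslate s (1 : S →ᵇ ℂ), trivial⟩ = 1 :=
    fun s => μ.map_one' _ rfl
  simpa only [h] using continuous_const

theorem mul_mem_Lmc {f g : S →ᵇ ℂ} (hf : f ∈ Lmc S) (hg : g ∈ Lmc S) : f * g ∈ Lmc S :=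
  fun μ => by
    have h : ∀ s : S, μ.toLin ⟨leftTranslate s (f * g), trivial⟩ =
        μ.toLin ⟨leftTranslate s f, trivial⟩ * μ.toLin ⟨leftTranslate s g, trivial⟩ :=
      fun s => μ.map_mul' ⟨leftTranslate s f, trivial⟩ ⟨leftTranslate s g, trivial⟩ _ rfl
    exact ((hf μ).mul (hg μ)).congr fun s => (h s).symm

theorem star_mem_Lmc {f : S →ᵇ ℂ} (hf : f ∈ Lmc S) : star f ∈ Lmc S := fun μ => by
  -- apply the hypothesis to the conjugate mean `f ↦ conj (μ (conj f))`
  let ν : Spectrum (⊤ : Submodule ℂ (S →ᵇ ℂ)) :=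
    { toLin :=
        { toFun := fun f => star (μ.toLin ⟨star (f : S →ᵇ ℂ), trivial⟩)
          map_add' := fun f g => by
            rw [← star_add, ← map_add]
            congr 2
            exact Subtype.ext (star_add _ _)
          map_smul' := fun a f => by
            have h : (⟨star ((a • f : (⊤ : Submodule ℂ (S →ᵇ ℂ))) : S →ᵇ ℂ), trivial⟩ :
                (⊤ : Submodule ℂ (S →ᵇ ℂ))) = star a • ⟨star (f : S →ᵇ ℂ), trivial⟩ :=
              Subtype.ext (star_smul _ _)
            rw [h, map_smul, star_smul, star_star, RingHom.id_apply] }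
      map_one' := fun e he => by
        change star (μ.toLin ⟨star (e : S →ᵇ ℂ), trivial⟩) = 1
        rw [μ.map_one' ⟨star (e : S →ᵇ ℂ), trivial⟩ (by simp [he]), star_one]
      map_mul' := fun f g h hh => by
        change star (μ.toLin ⟨star (h : S →ᵇ ℂ), trivial⟩) = star (μ.toLin ⟨star (f : S →ᵇ ℂ),
          trivial⟩) * star (μ.toLin ⟨star (g : S →ᵇ ℂ), trivial⟩)
        rw [μ.map_mul' ⟨star (f : S →ᵇ ℂ), trivial⟩ ⟨star (g : S →ᵇ ℂ), trivial⟩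
          ⟨star (h : S →ᵇ ℂ), trivial⟩ (by simp [hh]), star_mul']
      norm_le' := fun f => by
        change ‖star (μ.toLin ⟨star (f : S →ᵇ ℂ), trivial⟩)‖ ≤ _
        rw [norm_star]
        refine (μ.norm_le' _).trans ?_
        change ‖star (f : S →ᵇ ℂ)‖ ≤ _
        rw [norm_star] }
  have h : ∀ s : S, μ.toLin ⟨leftTranslate s (star f), trivial⟩ =
      star (ν.toLin ⟨leftTranslate s f, trivial⟩) := fun s => by
    change _ = star (star (μ.toLin ⟨star (leftTranslate s f), trivial⟩))
    rw [star_star]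
    rfl
  exact ((hf ν).star).congr fun s => (h s).symm

theorem leftTranslate_mem_Lmc (s : S) {f : S →ᵇ ℂ} (hf : f ∈ Lmc S) :
    leftTranslate s f ∈ Lmc S := fun μ => by
  simpa only [leftTranslate_leftTranslate, Function.comp_def] using
    (hf μ).comp (continuous_const_mul s)

variable (S) in
/-- The space `S^{Lmc}`. -/
abbrev LmcCompactification : Type u := Spectrum (Lmc S)

/-- For `ν ∈ S^{Lmc}` and `f ∈ Lmc(S)`, the bounded continuous function
`T_ν f : s ↦ ν (L_s f)`. -/
noncomputable def lmcT (ν : LmcCompactification S) (f : Lmc S) : S →ᵇ ℂ :=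
  BoundedContinuousFunction.ofNormedAddCommGroup
    (fun s => ν.toLin ⟨leftTranslate s f, leftTranslate_mem_Lmc s f.2⟩)
    (by
      obtain ⟨μ, hμ⟩ := Spectrum.exists_extension one_mem_Lmc
        (fun _ hf _ hg => mul_mem_Lmc hf hg) (fun _ hf => star_mem_Lmc hf) ν
      have h := f.2 μ
      simpa only [← hμ] using h)
    ‖(f : S →ᵇ ℂ)‖
    (fun s => (ν.norm_le' _).trans (norm_leftTranslate_le s f))

theorem lmcT_add (ν : LmcCompactification S) (f g : Lmc S) :
    lmcT ν (f + g) = lmcT ν f + lmcT ν g := by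
  ext s
  exact ν.toLin.map_add ⟨leftTranslate s f, leftTranslate_mem_Lmc s f.2⟩
    ⟨leftTranslate s g, leftTranslate_mem_Lmc s g.2⟩

theorem lmcT_smul (ν : LmcCompactification S) (a : ℂ) (f : Lmc S) :
    lmcT ν (a • f) = a • lmcT ν f := by
  ext s
  exact ν.toLin.map_smul a ⟨leftTranslate s f, leftTranslate_mem_Lmc s f.2⟩

theorem lmcT_one (ν : LmcCompactification S) (e : Lmc S) (he : (e : S →ᵇ ℂ) = 1) :
    lmcT ν e = 1 := by
  ext s
  refine ν.map_one' _ ?_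
  change leftTranslate s (e : S →ᵇ ℂ) = 1
  rw [he]
  rfl

theorem lmcT_mul (ν : LmcCompactification S) (f g h : Lmc S)
    (hh : (h : S →ᵇ ℂ) = (f : S →ᵇ ℂ) * g) : lmcT ν h = lmcT ν f * lmcT ν g := by
  ext s
  refine ν.map_mul' ⟨leftTranslate s f, leftTranslate_mem_Lmc s f.2⟩
    ⟨leftTranslate s g, leftTranslate_mem_Lmc s g.2⟩ _ ?_
  change leftTranslate s (h : S →ᵇ ℂ) = _
  rw [hh]
  rfl

theorem norm_lmcT_le (ν : LmcCompactification S) (f : Lmc S) : ‖lmcT ν f‖ ≤ ‖(f : S →ᵇ ℂ)‖ :=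
  (BoundedContinuousFunction.norm_le (norm_nonneg _)).2 fun s =>
    (ν.norm_le' _).trans (norm_leftTranslate_le s f)

theorem leftTranslate_lmcT (ν : LmcCompactification S) (f : Lmc S) (s : S) :
    leftTranslate s (lmcT ν f) =
      lmcT ν ⟨leftTranslate s f, leftTranslate_mem_Lmc s f.2⟩ := by
  ext t
  change ν.toLin ⟨leftTranslate (s * t) f, _⟩ = ν.toLin ⟨leftTranslate t (leftTranslate s f), _⟩
  congr 2
  exact (leftTranslate_leftTranslate s t f).symm

/-- `Lmc(S)` is `m`-admissible. -/
theorem lmcT_mem_Lmc (ν : LmcCompactification S) (f : Lmc S) : lmcT ν f ∈ Lmc S := fun μ => by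
  let ρ : LmcCompactification S :=
    { toLin :=
        { toFun := fun f => μ.toLin ⟨lmcT ν f, trivial⟩
          map_add' := fun f g => by
            rw [← map_add]
            congr 1
            exact Subtype.ext (lmcT_add ν f g)
          map_smul' := fun a f => by
            rw [RingHom.id_apply, ← map_smul]
            congr 1
            exact Subtype.ext (lmcT_smul ν a f) }
      map_one' := fun e he => μ.map_one' _ (lmcT_one ν e he)
      map_mul' := fun f g h hh =>
        μ.map_mul' ⟨lmcT ν f, trivial⟩ ⟨lmcT ν g, trivial⟩ _ (lmcT_mul ν f g h hh)
      norm_le' := fun f => (μ.norm_le' _).trans (norm_lmcT_le ν f) }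
  have h := (lmcT ρ f).continuous
  have h2 : ∀ s : S, μ.toLin ⟨leftTranslate s (lmcT ν f), trivial⟩ = lmcT ρ f s := fun s => by
    change _ = μ.toLin ⟨lmcT ν ⟨leftTranslate s f, _⟩, trivial⟩
    congr 2
    exact leftTranslate_lmcT ν f s
  simpa only [h2] using h

/-- The multiplication of `S^{Lmc}`: `μ * ν = μ ∘ T_ν`, i.e. `(μ * ν)(f) = μ (T_ν f)`. -/
noncomputable instance LmcCompactification.instMul : Mul (LmcCompactification S) where
  mul μ ν :=
    { toLin :=
        { toFun := fun f => μ.toLin ⟨lmcT ν f, lmcT_mem_Lmc ν f⟩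
          map_add' := fun f g => by
            rw [← map_add]
            congr 1
            exact Subtype.ext (lmcT_add ν f g)
          map_smul' := fun a f => by
            rw [RingHom.id_apply, ← map_smul]
            congr 1
            exact Subtype.ext (lmcT_smul ν a f) }
      map_one' := fun e he => μ.map_one' _ (lmcT_one ν e he)
      map_mul' := fun f g h hh => μ.map_mul' ⟨lmcT ν f, lmcT_mem_Lmc ν f⟩
        ⟨lmcT ν g, lmcT_mem_Lmc ν g⟩ _ (lmcT_mul ν f g h hh)
      norm_le' := fun f => (μ.norm_le' _).trans (norm_lmcT_le ν f) }

variable (S) in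
/-- `Z(Lmc(S))`: the zero sets of the functions in `Lmc(S)`. -/
noncomputable def zeroSets : Set (Set S) := {A | ∃ f ∈ Lmc S, A = f ⁻¹' {0}}

/-- The closure of `ε(A)` in `S^{Lmc}`. -/
noncomputable def lmcClosure (A : Set S) : Set (LmcCompactification S) := closure (eval (Lmc S) '' A)

variable (S) in
/-- The remainder `S^* = S^{Lmc} - S`, where `S` stands for its image `ε(S)`. -/
noncomputable def remainder : Set (LmcCompactification S) := (Set.range (eval (Lmc S)))ᶜ

/-- `A ⊆ S` is unbounded if its closure in `S^{Lmc}` meets `S^*`. -/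
noncomputable def Unbounded (A : Set S) : Prop := (lmcClosure A ∩ remainder S).Nonempty

variable (S) in
/-- `wap(S)`: the bounded continuous functions whose set `R_S f` of right translates is relatively
compact in the weak topology of the Banach space of bounded continuous functions. -/
noncomputable def wap : Submodule ℂ (S →ᵇ ℂ) where
  carrier := {f | IsCompact
    (closure (Set.range fun s : S => toWeakSpace ℂ (S →ᵇ ℂ) (rightTranslate s f)))}
  add_mem' := fun {f g} hf hg => by
    refine IsCompact.closure_of_subset (hf.add hg) ?_
    rintro _ ⟨s, rfl⟩
    exact ⟨_, subset_closure ⟨s, rfl⟩, _, subset_closure ⟨s, rfl⟩, rfl⟩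
  zero_mem' := by
    refine IsCompact.closure_of_subset
      (isCompact_singleton (x := toWeakSpace ℂ (S →ᵇ ℂ) 0)) ?_
    rintro _ ⟨s, rfl⟩
    rfl
  smul_mem' := fun a f hf => by
    refine IsCompact.closure_of_subset (hf.image (continuous_const_smul a)) ?_
    rintro _ ⟨s, rfl⟩
    exact ⟨_, subset_closure ⟨s, rfl⟩, rfl⟩

theorem one_mem_wap : (1 : S →ᵇ ℂ) ∈ wap S := by
  refine IsCompact.closure_of_subset
    (isCompact_singleton (x := toWeakSpace ℂ (S →ᵇ ℂ) 1)) ?_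
  rintro _ ⟨s, rfl⟩
  rfl

variable (S) in
/-- The space `S^{wap}`: the spectrum of `wap(S)`. -/
abbrev WapCompactification : Type u := Spectrum (wap S)

end Compactification

end SemitopologicalSemigroup

/-! Both `wap S` and `Lmc S` are unital self-adjoint algebras with `wap S ≤ Lmc S`. Means therefore
extend to all bounded continuous functions, which gives card S^wap ≤ card S^Lmc. Conversely, let D
be the closure of S^* * S^Lmc and let g be continuous on S^Lmc with g = 0 on D. The family φ_ν(s) =
g(ε(s) * ν), with ν in the compact space S^Lmc, contains all right translates of g ∘ ε. A point μ of
βS sends φ_ν to g(μ' * ν), where μ' is the restriction of μ to `Lmc S`. As a function of ν this is 0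
if μ' ∈ S^*, and continuous if μ' ∈ ε(S). So φ is pointwise continuous on βS, hence weakly
continuous by Grothendieck's theorem (`continuous_apply_of_pointwise`), and g ∘ ε is weakly almost
periodic (`compEval_mem_wap`). By Urysohn such g separate the points of any set disjoint from D, in
particular of the closure of A, which therefore injects into S^wap (`mk_le_mk_wapCompactification`).
-/

section Variation

/-! ### Total variation of a functional on C(K, ℂ). -/

open MeasureTheory
open scoped NNReal CompactlySupported

variable {K : Type*} [TopologicalSpace K]

/-- The values of a functional on the continuous functions dominated by `h`. -/
def dominatedValues (Φ : C(K, ℂ) →L[ℂ] ℂ) (h : K → ℝ≥0) : Set ℝ≥0 :=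
  {r | ∃ g : C(K, ℂ), (∀ x, ‖g x‖₊ ≤ h x) ∧ r = ‖Φ g‖₊}

theorem dominatedValues_nonempty (Φ : C(K, ℂ) →L[ℂ] ℂ) (h : K → ℝ≥0) :
    (dominatedValues Φ h).Nonempty :=
  ⟨‖Φ 0‖₊, 0, fun x => by simp, rfl⟩

/-- The total variation of a functional on `C(K, ℂ)`, evaluated at a nonnegative function. -/
noncomputable def functionalVariation (Φ : C(K, ℂ) →L[ℂ] ℂ) (h : K → ℝ≥0) : ℝ≥0 :=
  sSup (dominatedValues Φ h)

theorem functionalVariation_le (Φ : C(K, ℂ) →L[ℂ] ℂ) {h : K → ℝ≥0} {r : ℝ≥0}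
    (H : ∀ g : C(K, ℂ), (∀ x, ‖g x‖₊ ≤ h x) → ‖Φ g‖₊ ≤ r) : functionalVariation Φ h ≤ r :=
  csSup_le (dominatedValues_nonempty Φ h) (by rintro _ ⟨g, hg, rfl⟩; exact H g hg)

variable [CompactSpace K]

/-- The supremum of an unbounded set in `ℝ≥0` is the default value 0; this bound makes the variation
meaningful. -/
theorem bddAbove_dominatedValues (Φ : C(K, ℂ) →L[ℂ] ℂ) {h : K → ℝ≥0} (hh : Continuous h) :
    BddAbove (dominatedValues Φ h) := by
  obtain ⟨M, hM⟩ := (isCompact_range hh).bddAbove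
  refine ⟨‖Φ‖₊ * M, ?_⟩
  rintro _ ⟨g, hg, rfl⟩
  refine (Φ.le_opNNNorm g).trans ?_
  gcongr
  refine NNReal.coe_le_coe.1 ((ContinuousMap.norm_le g M.2).2 ?_)
  exact fun x => NNReal.coe_le_coe.2 ((hg x).trans (hM ⟨x, rfl⟩))

theorem nnnorm_le_functionalVariation (Φ : C(K, ℂ) →L[ℂ] ℂ) {h : K → ℝ≥0} (hh : Continuous h)
    {g : C(K, ℂ)} (hg : ∀ x, ‖g x‖₊ ≤ h x) : ‖Φ g‖₊ ≤ functionalVariation Φ h :=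
  le_csSup (bddAbove_dominatedValues Φ hh) ⟨g, hg, rfl⟩

theorem Complex.nnnorm_coe_nnreal (r : ℝ≥0) : ‖((r : ℝ) : ℂ)‖₊ = r := by
  ext; simp

/-- A continuous function dominated by `h₁ + h₂` splits accordingly. -/
theorem exists_add_eq_of_nnnorm_le_add {K : Type*} [TopologicalSpace K] {h₁ h₂ : K → ℝ≥0}
    (c₁ : Continuous h₁) (c₂ : Continuous h₂)
    (g : C(K, ℂ)) (hg : ∀ x, ‖g x‖₊ ≤ h₁ x + h₂ x) :
    ∃ g₁ g₂ : C(K, ℂ), g₁ + g₂ = g ∧ (∀ x, ‖g₁ x‖₊ ≤ h₁ x) ∧ ∀ x, ‖g₂ x‖₊ ≤ h₂ x := by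
  have hg0 : ∀ x, h₁ x + h₂ x = 0 → g x = 0 := fun x hx => by
    have := hg x
    rw [hx] at this
    simpa using this
  -- The pieces are g hᵢ / (h₁ + h₂). Where the denominator vanishes so does g, and the bound by |g|
  -- gives continuity there.
  have key : ∀ k : K → ℝ≥0, Continuous k → (∀ x, k x ≤ h₁ x + h₂ x) →
      ∃ G : C(K, ℂ), (∀ x, G x = ((k x / (h₁ x + h₂ x) : ℝ≥0) : ℝ) * g x) ∧
        ∀ x, ‖G x‖₊ ≤ k x := by
    intro k ck hk
    have hle : ∀ x, ‖(((k x / (h₁ x + h₂ x) : ℝ≥0) : ℝ) : ℂ) * g x‖₊ ≤ ‖g x‖₊ := fun x => by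
      rw [nnnorm_mul, Complex.nnnorm_coe_nnreal]
      exact mul_le_of_le_one_left' (div_le_one_of_le₀ (hk x) zero_le)
    refine ⟨⟨fun x => ((k x / (h₁ x + h₂ x) : ℝ≥0) : ℝ) * g x,
      continuous_iff_continuousAt.2 fun x => ?_⟩, fun _ => rfl, fun x => ?_⟩
    · by_cases hx : h₁ x + h₂ x = 0
      · have h0 : Filter.Tendsto (fun y => ‖g y‖) (𝓝 x) (𝓝 0) := by
          simpa [hg0 x hx] using (g.continuous.norm.tendsto x)
        have := squeeze_zero_norm (fun y => NNReal.coe_le_coe.2 (hle y)) h0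
        simpa [ContinuousAt, hg0 x hx] using this
      · have : ContinuousAt (fun x => (k x / (h₁ x + h₂ x) : ℝ≥0)) x :=
          ck.continuousAt.div₀ (c₁.add c₂).continuousAt hx
        exact (Complex.continuous_ofReal.continuousAt.comp
          (NNReal.continuous_coe.continuousAt.comp this)).mul g.continuous.continuousAt
    · change ‖(((k x / (h₁ x + h₂ x) : ℝ≥0) : ℝ) : ℂ) * g x‖₊ ≤ k x
      rw [nnnorm_mul, Complex.nnnorm_coe_nnreal]
      calc k x / (h₁ x + h₂ x) * ‖g x‖₊ ≤ k x / (h₁ x + h₂ x) * (h₁ x + h₂ x) := by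
            gcongr; exact hg x
        _ ≤ k x := by
          rcases eq_or_ne (h₁ x + h₂ x) 0 with hx | hx
          · simp [hx]
          · rw [div_mul_cancel₀ _ hx]
  obtain ⟨g₁, e₁, b₁⟩ := key h₁ c₁ fun x => le_self_add
  obtain ⟨g₂, e₂, b₂⟩ := key h₂ c₂ fun x => le_add_self
  refine ⟨g₁, g₂, ContinuousMap.ext fun x => ?_, b₁, b₂⟩
  rw [ContinuousMap.add_apply, e₁, e₂, ← add_mul, ← Complex.ofReal_add, ← NNReal.coe_add,
    ← add_div]
  by_cases hx : h₁ x + h₂ x = 0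
  · simp [hg0 x hx]
  · simp [div_self hx]

/-- Subadditivity comes from splitting g. For superadditivity, unimodular factors rotate Φ g₁ and Φ
g₂ onto the positive axis, so that their moduli add. -/
theorem functionalVariation_add (Φ : C(K, ℂ) →L[ℂ] ℂ) {h₁ h₂ : K → ℝ≥0} (c₁ : Continuous h₁)
    (c₂ : Continuous h₂) : functionalVariation Φ (h₁ + h₂) =
      functionalVariation Φ h₁ + functionalVariation Φ h₂ := by
  apply le_antisymm
  · refine functionalVariation_le Φ fun g hg => ?_
    obtain ⟨g₁, g₂, rfl, b₁, b₂⟩ := exists_add_eq_of_nnnorm_le_add c₁ c₂ g hg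
    rw [map_add]
    exact (nnnorm_add_le _ _).trans (add_le_add (nnnorm_le_functionalVariation Φ c₁ b₁)
      (nnnorm_le_functionalVariation Φ c₂ b₂))
  · have key : ∀ g₁ g₂ : C(K, ℂ), (∀ x, ‖g₁ x‖₊ ≤ h₁ x) → (∀ x, ‖g₂ x‖₊ ≤ h₂ x) →
        ‖Φ g₁‖₊ + ‖Φ g₂‖₊ ≤ functionalVariation Φ (h₁ + h₂) := by
      intro g₁ g₂ b₁ b₂
      obtain ⟨a₁, n₁, e₁⟩ := RCLike.exists_norm_eq_mul_self (Φ g₁)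
      obtain ⟨a₂, n₂, e₂⟩ := RCLike.exists_norm_eq_mul_self (Φ g₂)
      have h := nnnorm_le_functionalVariation Φ (c₁.add c₂) (g := a₁ • g₁ + a₂ • g₂) fun x => by
        refine (nnnorm_add_le _ _).trans (add_le_add ?_ ?_)
        · have : ‖a₁‖₊ = 1 := NNReal.eq n₁
          simpa [this] using b₁ x
        · have : ‖a₂‖₊ = 1 := NNReal.eq n₂
          simpa [this] using b₂ x
      refine le_trans (le_of_eq ?_) h
      rw [map_add, map_smul, map_smul, smul_eq_mul, smul_eq_mul, ← e₁, ← e₂]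
      have h3 := Complex.nnnorm_coe_nnreal (‖Φ g₁‖₊ + ‖Φ g₂‖₊)
      rw [← h3]
      simp
    have h2 : ∀ g₁ : C(K, ℂ), (∀ x, ‖g₁ x‖₊ ≤ h₁ x) →
        functionalVariation Φ h₂ ≤ functionalVariation Φ (h₁ + h₂) - ‖Φ g₁‖₊ := fun g₁ b₁ =>
      functionalVariation_le Φ fun g₂ b₂ => le_tsub_of_add_le_left (key g₁ g₂ b₁ b₂)
    -- Subtraction in `ℝ≥0` is truncated, so undoing it requires the subtrahend to be the smaller
    -- term; `h3` and `h4` provide this.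
    have h3 : functionalVariation Φ h₂ ≤ functionalVariation Φ (h₁ + h₂) := by
      simpa using h2 0 (by simp)
    refine add_le_of_le_tsub_right_of_le h3 (functionalVariation_le Φ fun g₁ b₁ => ?_)
    refine le_tsub_of_add_le_left ?_
    have h4 : ‖Φ g₁‖₊ ≤ functionalVariation Φ (h₁ + h₂) := by
      simpa using key g₁ 0 b₁ (by simp)
    exact add_le_of_le_tsub_right_of_le h4 (h2 g₁ b₁)

theorem functionalVariation_smul_le (Φ : C(K, ℂ) →L[ℂ] ℂ) {h : K → ℝ≥0} (hh : Continuous h)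
    (c : ℝ≥0) : c * functionalVariation Φ h ≤ functionalVariation Φ (c • h) := by
  rcases eq_or_ne c 0 with rfl | hc
  · simp
  rw [← le_inv_mul_iff₀ (pos_iff_ne_zero.2 hc)]
  refine functionalVariation_le Φ fun g hg => ?_
  rw [le_inv_mul_iff₀ (pos_iff_ne_zero.2 hc)]
  have h2 := nnnorm_le_functionalVariation Φ (hh.const_smul c)
    (g := ((c : ℝ) : ℂ) • g) fun x => by
      rw [ContinuousMap.smul_apply, nnnorm_smul, Complex.nnnorm_coe_nnreal]
      exact mul_le_mul_right (hg x) c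
  rwa [map_smul, nnnorm_smul, Complex.nnnorm_coe_nnreal] at h2

/-- The missing inequality is the previous one applied to c⁻¹ and c • h. -/
theorem functionalVariation_smul (Φ : C(K, ℂ) →L[ℂ] ℂ) {h : K → ℝ≥0} (hh : Continuous h)
    (c : ℝ≥0) : functionalVariation Φ (c • h) = c * functionalVariation Φ h := by
  refine le_antisymm ?_ (functionalVariation_smul_le Φ hh c)
  rcases eq_or_ne c 0 with rfl | hc
  · refine functionalVariation_le Φ fun g hg => ?_
    have : g = 0 := ContinuousMap.ext fun x => by simpa using hg x
    simp [this]
  have h2 := functionalVariation_smul_le Φ (hh.const_smul c) c⁻¹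
  rw [inv_smul_smul₀ hc] at h2
  rwa [inv_mul_le_iff₀ (pos_iff_ne_zero.2 hc)] at h2

/-- Every functional on `C(K, ℂ)` is dominated by the integral of the modulus against a finite
measure. -/
theorem exists_measure_norm_apply_le_integral_norm [T2Space K] [MeasurableSpace K] [BorelSpace K]
    (Φ : C(K, ℂ) →L[ℂ] ℂ) :
    ∃ m : Measure K, IsFiniteMeasure m ∧ ∀ g : C(K, ℂ), ‖Φ g‖ ≤ ∫ x, ‖g x‖ ∂m := by
  -- The variation is additive and positively homogeneous, so Riesz–Markov represents it by a
  -- measure.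
  let Λ : C_c(K, ℝ≥0) →ₗ[ℝ≥0] ℝ≥0 :=
    { toFun := fun h => functionalVariation Φ h
      map_add' := fun h k => functionalVariation_add Φ h.continuous k.continuous
      map_smul' := fun c h => functionalVariation_smul Φ h.continuous c }
  refine ⟨NNRealRMK.rieszMeasure Λ, inferInstance, fun g => ?_⟩
  let h : C_c(K, ℝ≥0) := ⟨⟨fun x => ‖g x‖₊, g.continuous.nnnorm⟩,
    HasCompactSupport.of_compactSpace _⟩
  have h1 := NNRealRMK.integral_rieszMeasure Λ h
  change ∫ x, ‖g x‖ ∂(NNRealRMK.rieszMeasure Λ) = (functionalVariation Φ h : ℝ) at h1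
  rw [h1]
  exact NNReal.coe_le_coe.2 (nnnorm_le_functionalVariation Φ h.continuous fun x => le_rfl)

end Variation

/-! ### Grothendieck's theorem: bounded pointwise continuity implies weak continuity. -/

section Grothendieck

open MeasureTheory Filter

variable {K L : Type*} [TopologicalSpace K] [CompactSpace K] [TopologicalSpace L]

/-- Finitely many continuous functions on a compact space are determined, up to `δ`, by their
values at finitely many points. -/
theorem exists_finset_forall_dist_lt {L Y : Type*} [PseudoMetricSpace Y] (F : L → C(K, Y))
    (T : Finset L) {δ : ℝ} (hδ : 0 < δ) :
    ∃ D : Finset K, ∀ x, ∃ y ∈ D, ∀ k ∈ T, dist (F k x) (F k y) < δ := by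
  obtain ⟨D, hD⟩ := CompactSpace.elim_nhds_subcover
    (fun y => {x | ∀ k ∈ T, dist (F k x) (F k y) < δ}) fun y => by
      refine (eventually_all_finset T).2 fun k _ => ?_
      have : Tendsto (fun x => dist (F k x) (F k y)) (𝓝 y) (𝓝 0) := by
        have h := ((F k).continuous.dist (continuous_const (y := F k y))).tendsto y
        simpa using h
      exact this.eventually_lt_const hδ
  refine ⟨D, fun x => ?_⟩
  have : x ∈ ⋃ y ∈ D, {x | ∀ k ∈ T, dist (F k x) (F k y) < δ} := hD ▸ Set.mem_univ x
  simpa using this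

/-- For a separately continuous family of continuous functions on a compact space, parametrised by
a compact space, adherence along a predicate is realised by a pointwise convergent sequence. -/
theorem exists_seq_tendsto_of_frequently [CompactSpace L] (F : L → C(K, ℂ))
    (hF : ∀ x, Continuous fun ν => F ν x) {ν₀ : L} {p : L → Prop} (hp : ∃ᶠ ν in 𝓝 ν₀, p ν) :
    ∃ ν : ℕ → L, (∀ n, p (ν n)) ∧ ∀ x, Tendsto (fun n => F (ν n) x) atTop (𝓝 (F ν₀ x)) := by
  classical
  have hδ : ∀ n : ℕ, (0 : ℝ) < 1 / (n + 1) := fun n => Nat.one_div_pos_of_nat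
  choose D hD using fun (T : Finset L) (n : ℕ) => exists_finset_forall_dist_lt F T (hδ n)
  have hpick : ∀ (E : Finset K) (n : ℕ), ∃ ν, p ν ∧
      ∀ y ∈ E, dist (F ν y) (F ν₀ y) < 1 / ((n : ℝ) + 1) := fun E n => by
    have : ∀ᶠ ν in 𝓝 ν₀, ∀ y ∈ E, dist (F ν y) (F ν₀ y) < 1 / ((n : ℝ) + 1) := by
      refine (eventually_all_finset E).2 fun y _ => ?_
      exact Metric.tendsto_nhds.1 ((hF y).tendsto ν₀) _ (hδ n)
    exact (hp.and_eventually this).exists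
  choose pick hpick1 hpick2 using hpick
  -- The state is a finite set T of parameters and a finite set E of points. Stage n adds to E
  -- points that represent all of K up to 1/(n+1) for the functions in T, then adds to T a parameter
  -- that is 1/(n+1)-close to ν₀ on the enlarged E.
  let st : ℕ → Finset L × Finset K := fun n => Nat.rec ({ν₀}, ∅)
    (fun n s => (insert (pick (s.2 ∪ D s.1 n) n) s.1, s.2 ∪ D s.1 n)) n
  have st1 : ∀ n, (st (n + 1)).1 = insert (pick ((st n).2 ∪ D (st n).1 n) n) (st n).1 :=
    fun n => rfl
  have st2 : ∀ n, (st (n + 1)).2 = (st n).2 ∪ D (st n).1 n := fun n => rfl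
  have mono1 : Monotone fun n => (st n).1 := monotone_nat_of_le_succ fun n => by
    rw [st1]; exact Finset.subset_insert _ _
  have mono2 : Monotone fun n => (st n).2 := monotone_nat_of_le_succ fun n => by
    rw [st2]; exact Finset.subset_union_left
  let ν : ℕ → L := fun n => pick ((st n).2 ∪ D (st n).1 n) n
  have hν1 : ∀ {m n}, m < n → ν m ∈ (st n).1 := fun {m n} h =>
    mono1 (Nat.succ_le_of_lt h) (by
      change ν m ∈ (st (m + 1)).1
      rw [st1]; exact Finset.mem_insert_self _ _)
  have hν0 : ∀ n, ν₀ ∈ (st n).1 := fun n => mono1 (Nat.zero_le n) (Finset.mem_singleton_self ν₀)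
  have hν2 : ∀ {m n : ℕ} {y : K}, m ≤ n → y ∈ D (st m).1 m →
      dist (F (ν n) y) (F ν₀ y) < 1 / ((n : ℝ) + 1) := fun {m n y} h hy => by
    refine hpick2 _ n y ?_
    have : y ∈ (st (n + 1)).2 := mono2 (Nat.succ_le_succ h) (by
      change y ∈ (st (m + 1)).2
      rw [st2]; exact Finset.mem_union_right _ hy)
    rwa [st2] at this
  refine ⟨ν, fun n => hpick1 _ _, fun x => ?_⟩
  choose y hyD hy using fun n => hD (st n).1 n x
  -- Along an ultrafilter ν n → νl and y n → yl. The goal is the chain F νl x = F νl yl = F ν₀ yl =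
  -- F ν₀ x.
  refine tendsto_iff_ultrafilter _ _ _ |>.2 fun U hU => ?_
  obtain ⟨νl, -, hνl⟩ := isCompact_univ.ultrafilter_le_nhds (U.map ν) (by simp)
  obtain ⟨yl, -, hyl⟩ := isCompact_univ.ultrafilter_le_nhds (U.map y) (by simp)
  have hνl : Tendsto ν U (𝓝 νl) := hνl
  have hyl : Tendsto y U (𝓝 yl) := hyl
  have hzero : Tendsto (fun n : ℕ => 1 / ((n : ℝ) + 1)) U (𝓝 0) :=
    tendsto_one_div_add_atTop_nhds_zero_nat.mono_left hU
  -- Parameters that eventually enter T do not distinguish x from yl, since y n represents x for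
  -- them up to 1/(n+1).
  have same : ∀ k : L, (∀ᶠ n in atTop, k ∈ (st n).1) → F k x = F k yl := fun k hk => by
    have h1 : Tendsto (fun n => dist (F k x) (F k (y n))) U (𝓝 (dist (F k x) (F k yl))) :=
      tendsto_const_nhds.dist (((F k).continuous.tendsto yl).comp hyl)
    refine dist_le_zero.1 (le_of_tendsto_of_tendsto h1 hzero ?_)
    filter_upwards [hU hk] with n hn using (hy n k hn).le
  have hlim : F νl x = F νl yl :=
    tendsto_nhds_unique (((hF x).tendsto νl).comp hνl)
      ((((hF yl).tendsto νl).comp hνl).congr fun m => (same (ν m)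
        ((eventually_gt_atTop m).mono fun n hn => hν1 hn)).symm)
  -- Once y n is in E, all later parameters match ν₀ there with error tending to 0.
  have hyn : ∀ n, F νl (y n) = F ν₀ (y n) := fun n => by
    have h1 : Tendsto (fun m => dist (F (ν m) (y n)) (F ν₀ (y n))) U
        (𝓝 (dist (F νl (y n)) (F ν₀ (y n)))) :=
      (((hF (y n)).tendsto νl).comp hνl).dist tendsto_const_nhds
    refine dist_le_zero.1 (le_of_tendsto_of_tendsto h1 hzero ?_)
    filter_upwards [hU (eventually_ge_atTop n)] with m hm using (hν2 hm (hyD n)).le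
  have hyl2 : F νl yl = F ν₀ yl :=
    tendsto_nhds_unique (((F νl).continuous.tendsto yl).comp hyl)
      ((((F ν₀).continuous.tendsto yl).comp hyl).congr fun n => (hyn n).symm)
  have hx : F νl x = F ν₀ x := by
    rw [hlim, hyl2, same ν₀ (Eventually.of_forall hν0)]
  rw [← hx]
  exact ((hF x).tendsto νl).comp hνl

/-- Grothendieck's theorem: a bounded family of continuous functions on a compact space that
depends pointwise continuously on a parameter in a compact space depends weakly continuously
on it. -/
theorem continuous_apply_of_pointwise [T2Space K] [CompactSpace L] (F : L → C(K, ℂ)) {M : ℝ}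
    (hM : ∀ ν, ‖F ν‖ ≤ M) (hF : ∀ x, Continuous fun ν => F ν x) (Φ : C(K, ℂ) →L[ℂ] ℂ) :
    Continuous fun ν => Φ (F ν) := by
  refine continuous_iff_continuousAt.2 fun ν₀ => Metric.tendsto_nhds.2 fun ε hε => ?_
  -- A failure of continuity yields a sequence with F (ν n) → F ν₀ pointwise but |Φ(F (ν n)) - Φ(F
  -- ν₀)| ≥ ε; dominated convergence against the variation measure contradicts this.
  by_contra hcon
  obtain ⟨ν, hν, hlim⟩ := exists_seq_tendsto_of_frequently F hF (not_eventually.1 hcon)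
  borelize K
  obtain ⟨m, _, hm⟩ := exists_measure_norm_apply_le_integral_norm Φ
  have h1 : Tendsto (fun n => ∫ x, ‖(F (ν n) - F ν₀) x‖ ∂m) atTop (𝓝 (∫ _, 0 ∂m)) := by
    refine tendsto_integral_of_dominated_convergence (fun _ => M + M)
      (fun n => (F (ν n) - F ν₀).continuous.norm.measurable.aestronglyMeasurable)
      (integrable_const _) (fun n => Eventually.of_forall fun x => ?_)
      (Eventually.of_forall fun x => ?_)
    · rw [norm_norm]
      exact ((F (ν n) - F ν₀).norm_coe_le_norm x).trans
        ((norm_sub_le _ _).trans (add_le_add (hM _) (hM _)))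
    · simpa using ((hlim x).sub_const (F ν₀ x)).norm
  rw [integral_zero] at h1
  refine not_lt_of_ge (ge_of_tendsto h1 (Eventually.of_forall fun n => ?_)) hε
  calc ε ≤ dist (Φ (F (ν n))) (Φ (F ν₀)) := not_lt.1 (hν n)
    _ = ‖Φ (F (ν n) - F ν₀)‖ := by rw [dist_eq_norm, map_sub]
    _ ≤ _ := hm _

end Grothendieck

namespace SemitopologicalSemigroup

/-! ### Topology of the spectrum and the criterion for weak continuity. -/

section SpectrumTopology

variable {S : Type u} [TopologicalSpace S]

theorem Spectrum.isInducing_toLin (F : Submodule ℂ (S →ᵇ ℂ)) :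
    Topology.IsInducing fun (μ : Spectrum F) (f : F) => μ.toLin f := ⟨rfl⟩

theorem Spectrum.toLin_injective (F : Submodule ℂ (S →ᵇ ℂ)) :
    Function.Injective fun (μ : Spectrum F) (f : F) => μ.toLin f := fun _ _ h =>
  Spectrum.ext (LinearMap.ext fun f => congrFun h f)

theorem Spectrum.continuous_toLin {F : Submodule ℂ (S →ᵇ ℂ)} (f : F) :
    Continuous fun μ : Spectrum F => μ.toLin f :=
  (continuous_apply f).comp (Spectrum.isInducing_toLin F).continuous

theorem Spectrum.continuous_of_toLin {F : Submodule ℂ (S →ᵇ ℂ)} {X : Type*} [TopologicalSpace X]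
    {φ : X → Spectrum F} (h : ∀ f : F, Continuous fun x => (φ x).toLin f) : Continuous φ :=
  (Spectrum.isInducing_toLin F).continuous_iff.2 (continuous_pi h)

instance Spectrum.instT2Space (F : Submodule ℂ (S →ᵇ ℂ)) : T2Space (Spectrum F) :=
  T2Space.of_injective_continuous (Spectrum.toLin_injective F)
    (Spectrum.isInducing_toLin F).continuous

/-- As in Banach–Alaoglu: the defining conditions are closed under pointwise limits inside a product
of discs. -/
instance Spectrum.instCompactSpace (F : Submodule ℂ (S →ᵇ ℂ)) : CompactSpace (Spectrum F) := by
  have hc : IsCompact (Set.univ.pi fun f : F => Metric.closedBall (0 : ℂ) ‖(f : S →ᵇ ℂ)‖) :=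
    isCompact_univ_pi fun f => isCompact_closedBall _ _
  refine ⟨(Spectrum.isInducing_toLin F).isCompact_iff.2 (hc.of_isClosed_subset ?_ ?_)⟩
  · have : (fun (μ : Spectrum F) (f : F) => μ.toLin f) '' Set.univ =
        {φ | (∀ f g, φ (f + g) = φ f + φ g) ∧ (∀ (a : ℂ) f, φ (a • f) = a • φ f) ∧
          (∀ e : F, (e : S →ᵇ ℂ) = 1 → φ e = 1) ∧
          (∀ f g h : F, (h : S →ᵇ ℂ) = (f : S →ᵇ ℂ) * g → φ h = φ f * φ g) ∧
          ∀ f : F, ‖φ f‖ ≤ ‖(f : S →ᵇ ℂ)‖} := by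
      ext φ
      constructor
      · rintro ⟨μ, -, rfl⟩
        exact ⟨μ.toLin.map_add, μ.toLin.map_smul, μ.map_one', μ.map_mul', μ.norm_le'⟩
      · rintro ⟨h1, h2, h3, h4, h5⟩
        exact ⟨⟨⟨⟨φ, h1⟩, h2⟩, h3, h4, h5⟩, trivial, rfl⟩
    rw [this]
    simp only [Set.ofPred_and, Set.ofPred_forall]
    refine .inter ?_ (.inter ?_ (.inter ?_ (.inter ?_ ?_)))
    · exact isClosed_iInter fun f => isClosed_iInter fun g =>
        isClosed_eq (by fun_prop) (by fun_prop)
    · exact isClosed_iInter fun f => isClosed_iInter fun g =>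
        isClosed_eq (by fun_prop) (by fun_prop)
    · exact isClosed_iInter fun f => isClosed_iInter fun _ =>
        isClosed_eq (by fun_prop) (by fun_prop)
    · exact isClosed_iInter fun f => isClosed_iInter fun g => isClosed_iInter fun h =>
        isClosed_iInter fun _ => isClosed_eq (by fun_prop) (by fun_prop)
    · exact isClosed_iInter fun f => isClosed_le (by fun_prop) (by fun_prop)
  · rintro _ ⟨μ, -, rfl⟩ f -
    exact mem_closedBall_zero_iff.2 (μ.norm_le' f)

theorem continuous_eval (F : Submodule ℂ (S →ᵇ ℂ)) : Continuous (eval F) :=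
  Spectrum.continuous_of_toLin fun f => (f : S →ᵇ ℂ).continuous

/-- The evaluations are dense in the spectrum of a self-adjoint algebra. -/
theorem denseRange_eval {F : Submodule ℂ (S →ᵇ ℂ)} (h1 : (1 : S →ᵇ ℂ) ∈ F)
    (hmul : ∀ f ∈ F, ∀ g ∈ F, f * g ∈ F) (hstar : ∀ f ∈ F, star f ∈ F) :
    DenseRange (eval F) := fun μ => by
  rw [(Spectrum.isInducing_toLin F).closure_eq_preimage_closure_image]
  change (fun f => μ.toLin f) ∈ closure _
  rw [mem_closure_iff_nhds]
  intro V hV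
  rw [nhds_pi, (Filter.hasBasis_pi fun f => Metric.nhds_basis_ball).mem_iff] at hV
  obtain ⟨⟨I, r⟩, ⟨hI, hr⟩, hV⟩ := hV
  obtain ⟨δ, hδ0, hδ⟩ : ∃ δ : ℝ, 0 < δ ∧ ∀ i ∈ I, δ < r i := by
    have h2 : ∀ᶠ δ : ℝ in 𝓝[>] 0, ∀ i ∈ I, δ < r i :=
      (Filter.eventually_all_finite hI).2 fun i hi =>
        nhdsWithin_le_nhds (Iio_mem_nhds (hr i hi))
    obtain ⟨δ, h3, h4⟩ := (h2.and self_mem_nhdsWithin).exists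
    exact ⟨δ, h4, h3⟩
  obtain ⟨s, hs⟩ := Spectrum.exists_near h1 hmul hstar μ hI.toFinset hδ0
  refine ⟨_, hV fun f hf => ?_, eval F s, ⟨s, rfl⟩, rfl⟩
  rw [Metric.mem_ball, dist_eq_norm]
  exact (hs f (hI.mem_toFinset.2 hf)).trans (hδ f hf)

/-- The restriction to `F` of a mean on all bounded continuous functions. -/
noncomputable def Spectrum.restrict (F : Submodule ℂ (S →ᵇ ℂ))
    (μ : Spectrum (⊤ : Submodule ℂ (S →ᵇ ℂ))) :
    Spectrum F where
  toLin := μ.toLin ∘ₗ Submodule.inclusion le_top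
  map_one' := fun _ he => μ.map_one' _ he
  map_mul' := fun _ _ _ hh => μ.map_mul' _ _ _ hh
  norm_le' := fun _ => μ.norm_le' _

theorem Spectrum.continuous_restrict (F : Submodule ℂ (S →ᵇ ℂ)) :
    Continuous (Spectrum.restrict F) :=
  Spectrum.continuous_of_toLin fun f => Spectrum.continuous_toLin (Submodule.inclusion le_top f)

/-- Every mean on a self-adjoint algebra is the restriction of a mean on all bounded continuous
functions. -/
theorem Spectrum.restrict_surjective {F : Submodule ℂ (S →ᵇ ℂ)} (h1 : (1 : S →ᵇ ℂ) ∈ F)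
    (hmul : ∀ f ∈ F, ∀ g ∈ F, f * g ∈ F) (hstar : ∀ f ∈ F, star f ∈ F) :
    Function.Surjective (Spectrum.restrict F) := fun μ => by
  obtain ⟨ν, hν⟩ := Spectrum.exists_extension h1 hmul hstar μ
  exact ⟨ν, Spectrum.ext (LinearMap.ext hν)⟩

/-- Composition with the evaluation map, as a bounded operator. -/
noncomputable def compEval (F : Submodule ℂ (S →ᵇ ℂ)) : C(Spectrum F, ℂ) →L[ℂ] (S →ᵇ ℂ) :=
  LinearMap.mkContinuous
    { toFun := fun g => (BoundedContinuousFunction.mkOfCompact g).compContinuous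
        ⟨eval F, continuous_eval F⟩
      map_add' := fun _ _ => rfl
      map_smul' := fun _ _ => rfl } 1 fun g => by
    rw [one_mul]
    exact (BoundedContinuousFunction.norm_le (norm_nonneg _)).2 fun s =>
      g.norm_coe_le_norm (eval F s)

theorem denseRange_eval_top : DenseRange (eval (⊤ : Submodule ℂ (S →ᵇ ℂ))) :=
  denseRange_eval trivial (fun _ _ _ _ => trivial) fun _ _ => trivial

/-- Both sides are continuous in μ and agree on the dense set of evaluations. -/
theorem Spectrum.apply_compEval {F : Submodule ℂ (S →ᵇ ℂ)} (g : C(Spectrum F, ℂ))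
    (μ : Spectrum (⊤ : Submodule ℂ (S →ᵇ ℂ))) :
    μ.toLin ⟨compEval F g, trivial⟩ = g (μ.restrict F) :=
  congrFun (denseRange_eval_top.equalizer
    (Spectrum.continuous_toLin (⟨compEval F g, trivial⟩ : (⊤ : Submodule ℂ (S →ᵇ ℂ))))
    (g.continuous.comp (Spectrum.continuous_restrict F)) rfl) μ

theorem Spectrum.apply_star (f : S →ᵇ ℂ) (μ : Spectrum (⊤ : Submodule ℂ (S →ᵇ ℂ))) :
    μ.toLin ⟨star f, trivial⟩ = star (μ.toLin ⟨f, trivial⟩) :=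
  congrFun (denseRange_eval_top.equalizer
    (Spectrum.continuous_toLin (⟨star f, trivial⟩ : (⊤ : Submodule ℂ (S →ᵇ ℂ))))
    (Spectrum.continuous_toLin (⟨f, trivial⟩ : (⊤ : Submodule ℂ (S →ᵇ ℂ)))).star rfl) μ

/-- A bounded family in the space of bounded continuous functions, parametrised by a compact space,
is weakly continuous as soon as all multiplicative means are continuous along it. -/
theorem continuous_toWeakSpace_of_spectrum {L : Type*} [TopologicalSpace L] [CompactSpace L]
    {φ : L → S →ᵇ ℂ} {M : ℝ} (hM : ∀ ν, ‖φ ν‖ ≤ M)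
    (hφ : ∀ μ : Spectrum (⊤ : Submodule ℂ (S →ᵇ ℂ)),
      Continuous fun ν => μ.toLin ⟨φ ν, trivial⟩) :
    Continuous fun ν => toWeakSpace ℂ (S →ᵇ ℂ) (φ ν) := by
  refine WeakBilin.continuous_of_continuous_eval _ fun Φ => ?_
  let F : L → C(Spectrum (⊤ : Submodule ℂ (S →ᵇ ℂ)), ℂ) := fun ν =>
    ⟨fun μ => μ.toLin ⟨φ ν, trivial⟩, Spectrum.continuous_toLin _⟩
  -- M can be negative only when L is empty; the maximum avoids that case distinction.
  have hF : ∀ ν, ‖F ν‖ ≤ max M 0 := fun ν =>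
    (ContinuousMap.norm_le _ (le_max_right _ _)).2 fun μ =>
      (μ.norm_le' _).trans ((hM ν).trans (le_max_left _ _))
  have hFφ : ∀ ν, compEval _ (F ν) = φ ν := fun ν => rfl
  have := continuous_apply_of_pointwise F hF hφ (Φ.comp (compEval ⊤))
  simp only [ContinuousLinearMap.comp_apply, hFφ] at this
  exact this

/-- A mean as a bounded functional. -/
noncomputable def Spectrum.toStrongDual (μ : Spectrum (⊤ : Submodule ℂ (S →ᵇ ℂ))) :
    StrongDual ℂ (S →ᵇ ℂ) :=
  LinearMap.mkContinuous
    { toFun := fun f => μ.toLin ⟨f, trivial⟩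
      map_add' := fun f g => μ.toLin.map_add ⟨f, trivial⟩ ⟨g, trivial⟩
      map_smul' := fun a f => μ.toLin.map_smul a ⟨f, trivial⟩ } 1 fun f => by
    rw [one_mul]
    exact μ.norm_le' ⟨f, trivial⟩

theorem Spectrum.continuous_weakSpace (μ : Spectrum (⊤ : Submodule ℂ (S →ᵇ ℂ))) :
    Continuous fun h : WeakSpace ℂ (S →ᵇ ℂ) =>
      μ.toLin ⟨(toWeakSpace ℂ (S →ᵇ ℂ)).symm h, trivial⟩ :=
  WeakBilin.eval_continuous (topDualPairing ℂ (S →ᵇ ℂ)).flip μ.toStrongDual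

end SpectrumTopology

/-! ### Weakly almost periodic functions and the two cardinal inequalities. -/

section WapCompactification

variable {S : Type u} [Semigroup S] [TopologicalSpace S] [SeparatelyContinuousMul S]

/-- The weak closure of the set of right translates of `f`. -/
def weakOrbitClosure (f : S →ᵇ ℂ) : Set (WeakSpace ℂ (S →ᵇ ℂ)) :=
  closure (Set.range fun s : S => toWeakSpace ℂ (S →ᵇ ℂ) (rightTranslate s f))

/-- The underlying function of a point of the weak orbit closure. -/
noncomputable def weakOrbitClosure.toFun (f : S →ᵇ ℂ) (h : weakOrbitClosure f) : S →ᵇ ℂ :=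
  (toWeakSpace ℂ (S →ᵇ ℂ)).symm h

theorem weakOrbitClosure.continuous_spectrum (f : S →ᵇ ℂ)
    (μ : Spectrum (⊤ : Submodule ℂ (S →ᵇ ℂ))) :
    Continuous fun h => μ.toLin ⟨weakOrbitClosure.toFun f h, trivial⟩ :=
  μ.continuous_weakSpace.comp continuous_subtype_val

theorem weakOrbitClosure.norm_toFun_le (f : S →ᵇ ℂ) (h : weakOrbitClosure f) :
    ‖weakOrbitClosure.toFun f h‖ ≤ ‖f‖ := by
  refine (BoundedContinuousFunction.norm_le (norm_nonneg _)).2 fun t => ?_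
  have hc : IsClosed {k : WeakSpace ℂ (S →ᵇ ℂ) |
      ‖(eval ⊤ t).toLin ⟨(toWeakSpace ℂ (S →ᵇ ℂ)).symm k, trivial⟩‖ ≤ ‖f‖} :=
    isClosed_le (eval ⊤ t).continuous_weakSpace.norm continuous_const
  refine closure_minimal ?_ hc h.2
  rintro _ ⟨s, rfl⟩
  exact f.norm_coe_le_norm (t * s)

/-- The translate `R_s f` as a point of the weak orbit closure. -/
noncomputable def weakOrbitClosure.translate (f : S →ᵇ ℂ) (s : S) : weakOrbitClosure f :=
  ⟨toWeakSpace ℂ (S →ᵇ ℂ) (rightTranslate s f), subset_closure ⟨s, rfl⟩⟩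

theorem compactSpace_weakOrbitClosure {f : S →ᵇ ℂ} (hf : f ∈ wap S) :
    CompactSpace (weakOrbitClosure f) := isCompact_iff_compactSpace.1 hf

/-- The working test for membership in `wap S`: the range of φ is a weakly compact set containing
every right translate, and only multiplicative means need checking. -/
theorem mem_wap_of_range {L : Type*} [TopologicalSpace L] [CompactSpace L]
    {f : S →ᵇ ℂ} {φ : L → S →ᵇ ℂ} {M : ℝ} (hM : ∀ ν, ‖φ ν‖ ≤ M)
    (hφ : ∀ μ : Spectrum (⊤ : Submodule ℂ (S →ᵇ ℂ)),
      Continuous fun ν => μ.toLin ⟨φ ν, trivial⟩)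
    (hf : ∀ s, ∃ ν, φ ν = rightTranslate s f) : f ∈ wap S := by
  refine (isCompact_range (continuous_toWeakSpace_of_spectrum hM hφ)).closure_of_subset ?_
  rintro _ ⟨s, rfl⟩
  obtain ⟨ν, hν⟩ := hf s
  exact ⟨ν, congrArg _ hν⟩

/-- Multiplicative means turn the product of two orbit points into a product of scalars, so joint
continuity on the product of the orbit closures is immediate. -/
theorem mul_mem_wap {f g : S →ᵇ ℂ} (hf : f ∈ wap S) (hg : g ∈ wap S) : f * g ∈ wap S := by
  have := compactSpace_weakOrbitClosure hf
  have := compactSpace_weakOrbitClosure hg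
  refine mem_wap_of_range (L := weakOrbitClosure f × weakOrbitClosure g)
    (φ := fun p => weakOrbitClosure.toFun f p.1 * weakOrbitClosure.toFun g p.2)
    (M := ‖f‖ * ‖g‖) (fun p => ?_) (fun μ => ?_) fun s => ?_
  · refine (norm_mul_le _ _).trans ?_
    gcongr
    · exact weakOrbitClosure.norm_toFun_le f p.1
    · exact weakOrbitClosure.norm_toFun_le g p.2
  · refine (((weakOrbitClosure.continuous_spectrum f μ).comp continuous_fst).mul
      ((weakOrbitClosure.continuous_spectrum g μ).comp continuous_snd)).congr fun p => ?_
    exact (μ.map_mul' _ _ _ rfl).symm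
  · exact ⟨(weakOrbitClosure.translate f s, weakOrbitClosure.translate g s), rfl⟩

theorem star_mem_wap {f : S →ᵇ ℂ} (hf : f ∈ wap S) : star f ∈ wap S := by
  have := compactSpace_weakOrbitClosure hf
  refine mem_wap_of_range (φ := fun h => star (weakOrbitClosure.toFun f h))
    (M := ‖f‖) (fun h => ?_) (fun μ => ?_) fun s => ?_
  · rw [norm_star]
    exact weakOrbitClosure.norm_toFun_le f h
  · simp only [Spectrum.apply_star]
    exact (weakOrbitClosure.continuous_spectrum f μ).star
  · exact ⟨weakOrbitClosure.translate f s, rfl⟩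

/-- Weakly almost periodic functions belong to `Lmc(S)`. -/
theorem wap_le_Lmc : wap S ≤ Lmc S := fun f hf μ => by
  have := compactSpace_weakOrbitClosure hf
  let e : weakOrbitClosure f → S → ℂ := fun h s => weakOrbitClosure.toFun f h s
  have he : Continuous e := continuous_pi fun s =>
    weakOrbitClosure.continuous_spectrum f (eval ⊤ s)
  let Ψ : Spectrum (⊤ : Submodule ℂ (S →ᵇ ℂ)) → S → ℂ := fun μ s =>
    μ.toLin ⟨leftTranslate s f, trivial⟩
  have hΨ : Continuous Ψ := continuous_pi fun s => Spectrum.continuous_toLin _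
  -- For an evaluation at t, Ψ is the translate R_t f. The pointwise image of the weakly compact
  -- orbit closure is closed, so by density it contains every Ψ μ.
  have hmem : Ψ μ ∈ Set.range e := by
    have hcl : IsClosed (Ψ ⁻¹' Set.range e) := (isCompact_range he).isClosed.preimage hΨ
    refine closure_minimal ?_ hcl (denseRange_eval_top μ)
    rintro _ ⟨t, rfl⟩
    exact ⟨weakOrbitClosure.translate f t, rfl⟩
  obtain ⟨h, hh⟩ := hmem
  change Continuous (Ψ μ)
  rw [← hh]
  exact (weakOrbitClosure.toFun f h).continuous

/-- A mean on `wap S` is extended to all of CB(S) and cut down to `Lmc S`; as `wap S ≤ Lmc S`, the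
result still determines it. -/
theorem mk_wapCompactification_le :
    Cardinal.mk (WapCompactification S) ≤ Cardinal.mk (LmcCompactification S) := by
  choose ext hext using Spectrum.restrict_surjective (S := S) one_mem_wap
    (fun _ hf _ hg => mul_mem_wap hf hg) fun _ hf => star_mem_wap hf
  refine Cardinal.mk_le_of_injective (f := fun μ => (ext μ).restrict (Lmc S)) fun μ ν h => ?_
  rw [← hext μ, ← hext ν]
  exact Spectrum.ext (LinearMap.ext fun f =>
    congrArg (fun ρ : LmcCompactification S => ρ.toLin ⟨f, wap_le_Lmc f.2⟩) h)

theorem Lmc_restrict_surjective : Function.Surjective (Spectrum.restrict (Lmc S)) :=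
  Spectrum.restrict_surjective one_mem_Lmc (fun _ hf _ hg => mul_mem_Lmc hf hg)
    fun _ hf => star_mem_Lmc hf

theorem continuous_eval_mul (s : S) :
    Continuous fun ν : LmcCompactification S => eval (Lmc S) s * ν :=
  Spectrum.continuous_of_toLin fun _ => Spectrum.continuous_toLin _

theorem continuous_mul_right (ν : LmcCompactification S) :
    Continuous fun μ : LmcCompactification S => μ * ν :=
  Spectrum.continuous_of_toLin fun _ => Spectrum.continuous_toLin _

/-- The function `s ↦ g (ε(s) * ν)`. -/
noncomputable def compEvalMul (g : C(LmcCompactification S, ℂ)) (ν : LmcCompactification S) :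
    S →ᵇ ℂ :=
  compEval (Lmc S) (g.comp ⟨fun μ => μ * ν, continuous_mul_right ν⟩)

/-- If `g` vanishes on `S^* * S^{Lmc}`, its restriction to `S` is weakly almost periodic. -/
theorem compEval_mem_wap (g : C(LmcCompactification S, ℂ))
    (hg : ∀ μ ∈ remainder S, ∀ ν, g (μ * ν) = 0) : compEval (Lmc S) g ∈ wap S := by
  refine mem_wap_of_range (φ := compEvalMul g) (M := ‖g‖) (fun ν => ?_) (fun μ => ?_) fun s => ?_
  · exact (BoundedContinuousFunction.norm_le (norm_nonneg _)).2 fun s => g.norm_coe_le_norm _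
  · simp only [compEvalMul, Spectrum.apply_compEval]
    change Continuous fun ν => g (μ.restrict (Lmc S) * ν)
    -- On S^* the hypothesis makes the function zero; on ε(S), where left multiplication is
    -- continuous, no hypothesis on g is needed.
    by_cases hμ : μ.restrict (Lmc S) ∈ remainder S
    · simpa only [hg _ hμ] using continuous_const
    · obtain ⟨s, hs⟩ := not_not.1 hμ
      rw [← hs]
      exact g.continuous.comp (continuous_eval_mul s)
  -- This uses ε(t) * ε(s) = ε(ts).
  · exact ⟨eval (Lmc S) s, rfl⟩

/-- Functions vanishing on D restrict to weakly almost periodic ones and separate the points of C,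
so distinct points of C induce distinct means on `wap S`. -/
theorem mk_le_mk_wapCompactification {C D : Set (LmcCompactification S)}
    (hD : IsClosed D) (hCD : Disjoint C D) (hDmul : ∀ μ ∈ remainder S, ∀ ν, μ * ν ∈ D) :
    Cardinal.mk C ≤ Cardinal.mk (WapCompactification S) := by
  choose ext hext using Lmc_restrict_surjective (S := S)
  refine Cardinal.mk_le_of_injective (f := fun μ : C => (ext μ).restrict (wap S)) fun μ ν h => ?_
  by_contra hne
  have hne : (μ : LmcCompactification S) ≠ ν := fun h2 => hne (Subtype.ext h2)
  -- Adjoining ν to D makes a single Urysohn function both vanish on D and separate μ from ν.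
  obtain ⟨k, hk0, hk1, -⟩ := exists_continuous_zero_one_of_isClosed
    (s := D ∪ {(ν : LmcCompactification S)}) (t := {(μ : LmcCompactification S)})
    (hD.union isClosed_singleton) isClosed_singleton (by
      rw [Set.disjoint_singleton_right]
      rintro (h2 | h2)
      · exact hCD.notMem_of_mem_left μ.2 h2
      · exact hne h2)
  let g : C(LmcCompactification S, ℂ) := ⟨fun ρ => (k ρ : ℂ), by fun_prop⟩
  have hw : compEval (Lmc S) g ∈ wap S := compEval_mem_wap g fun ρ hρ σ => by
    simp [g, hk0 (Or.inl (hDmul ρ hρ σ))]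
  have h2 : ∀ ρ : LmcCompactification S,
      ((ext ρ).restrict (wap S)).toLin ⟨compEval (Lmc S) g, hw⟩ = k ρ := fun ρ =>
    (Spectrum.apply_compEval g (ext ρ)).trans (by rw [hext]; rfl)
  have h3 := h2 μ
  change (ext μ).restrict (wap S) = (ext ν).restrict (wap S) at h
  rw [h, h2 ν, hk0 (Or.inr rfl), hk1 rfl] at h3
  simp at h3

end WapCompactification

end SemitopologicalSemigroup

theorem theorem3p20 {S : Type u} [Semigroup S] [TopologicalSpace S] [T2Space S]
    [SeparatelyContinuousMul S] [NoncompactSpace S]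
    (A : Set S) (hA : A ∈ SemitopologicalSemigroup.zeroSets S)
    (hAunb : SemitopologicalSemigroup.Unbounded A)
    (hcard : Cardinal.mk (SemitopologicalSemigroup.LmcCompactification S) =
      Cardinal.mk (SemitopologicalSemigroup.lmcClosure A))
    (hdisj : SemitopologicalSemigroup.lmcClosure A ∩
      closure (Set.image2 (fun μ ν : SemitopologicalSemigroup.LmcCompactification S => μ * ν)
        (SemitopologicalSemigroup.remainder S) Set.univ) = ∅) :
    Cardinal.mk (SemitopologicalSemigroup.WapCompactification S) =
      Cardinal.mk (SemitopologicalSemigroup.LmcCompactification S) := by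
  refine le_antisymm SemitopologicalSemigroup.mk_wapCompactification_le ?_
  rw [hcard]
  exact SemitopologicalSemigroup.mk_le_mk_wapCompactification isClosed_closure
    (Set.disjoint_iff_inter_eq_empty.2 hdisj) fun μ hμ ν =>
      subset_closure (Set.mem_image2_of_mem hμ (Set.mem_univ ν))
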